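/- Let $A$ be a (not necessarily unital) $C^*$-algebra and let $\mathrm{Prim}(A)$ be the set of primitive ideals of $A$ (kernels of nonzero irreducible $*$-representations on Hilbert spaces) with the hull-kernel topology. For $P,Q\in\mathrm{Prim}(A)$ write $P\approx Q$ if $f(P)=f(Q)$ for every bounded continuous function $f:\mathrm{Prim}(A)\to\mathbb{R}$. For $P\in\mathrm{Prim}(A)$ let $q_A(P)=\bigcap\{Q\in\mathrm{Prim}(A) : Q\approx P\}$, and let $\mathrm{Glimm}(A)=\{q_A(P) : P\in\mathrm{Prim}(A)\}$, which is naturally identified with $\mathrm{Prim}(A)/{\approx}$. Let $\tau_q$ be the quotient topology on $\mathrm{Glimm}(A)$ induced by $q_A$, and let $\tau_{cr}$ be the weakest topology on $\mathrm{Glimm}(A)$ for which every function $g:\mathrm{Glimm}(A)\to\mathbb{R}$ with $g\circ q_A$ bounded and continuous on $\mathrm{Prim}(A)$ is continuous. For $a\in A$ and $G\in\mathrm{Glimm}(A)$ let $\|a+G\|$ be the quotient norm in $A/G$. Compactness means that every open cover has a finite subcover; no separation axiom is included. Let $K$ be a $\tau_{cr}$-compact subset of $\mathrm{Glimm}(A)$.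 There are $a\in A$ and $\alpha>0$ such that $K\subset\{G\in\mathrm{Glimm}(A) : \|a+G\|\ge\alpha\}$ if and only if there is a compact subset $C\subset\mathrm{Prim}(A)$ such that $q_A(C)=K$. Moreover, a $\tau_{cr}$-compact set $K$ that satisfies these equivalent conditions is also $\tau_q$-compact. -/

import Mathlib

universe u

open scoped BoundedContinuousFunction

/-- A *-representation `π` of `A` on a Hilbert space `H` is (topologically) irreducible if it is
nonzero and the only closed invariant subspaces of `H` are `0` and `H`. -/
def IsIrreducibleRep {A H : Type*} [NonUnitalCStarAlgebra A] [NormedAddCommGroup H]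
    [InnerProductSpace ℂ H] [CompleteSpace H] (π : A →⋆ₙₐ[ℂ] (H →L[ℂ] H)) : Prop :=
  π ≠ 0 ∧ ∀ M : Submodule ℂ H, IsClosed (M : Set H) → (∀ a : A, ∀ ξ ∈ M, π a ξ ∈ M) →
    M = ⊥ ∨ M = ⊤

/-- A primitive ideal is the kernel of an irreducible *-representation. An irreducible
representation is cyclic, so its Hilbert space is the closure of an image of `A`, and it suffices
to take Hilbert spaces in the universe of `A`. -/
def IsPrimitiveIdeal {A : Type u} [NonUnitalCStarAlgebra A] (P : TwoSidedIdeal A) : Prop :=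
  ∃ (H : Type u) (_ : NormedAddCommGroup H) (_ : InnerProductSpace ℂ H) (_ : CompleteSpace H)
    (π : A →⋆ₙₐ[ℂ] (H →L[ℂ] H)), IsIrreducibleRep π ∧ ∀ a : A, a ∈ P ↔ π a = 0

/-- The set `Prim(A)` of primitive ideals. -/
def PrimSpace (A : Type u) [NonUnitalCStarAlgebra A] : Type u :=
  {P : TwoSidedIdeal A // IsPrimitiveIdeal P}

section PrimSpace

variable {A : Type u} [NonUnitalCStarAlgebra A]

theorem IsPrimitiveIdeal.ne_top {P : TwoSidedIdeal A} (hP : IsPrimitiveIdeal P) : P ≠ ⊤ := by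
  obtain ⟨H, _, _, _, π, hπ, hk⟩ := hP
  rintro rfl
  exact hπ.1 (by ext1 a; exact (hk a).1 trivial)

/-- Primitive ideals are prime. -/
theorem IsPrimitiveIdeal.prime {P : TwoSidedIdeal A} (hP : IsPrimitiveIdeal P)
    {I J : TwoSidedIdeal A} (h : I ⊓ J ≤ P) : I ≤ P ∨ J ≤ P := by
  obtain ⟨H, _, _, _, π, hπ, hk⟩ := hP
  by_contra! hcon
  obtain ⟨hI, hJ⟩ := hcon
  obtain ⟨i, hi, hiP⟩ := Set.not_subset.1 hI
  obtain ⟨j, hj, hjP⟩ := Set.not_subset.1 hJ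
  have hi0 : ¬ π i = 0 := fun h0 => hiP ((hk i).2 h0)
  have hj0 : ¬ π j = 0 := fun h0 => hjP ((hk j).2 h0)
  -- the closed invariant subspace of vectors killed by `π (i * a)` for every `a` and by `π i`
  let M : Submodule ℂ H :=
    { carrier := {ξ | π i ξ = 0 ∧ ∀ a, π (i * a) ξ = 0}
      add_mem' := by
        rintro x y ⟨hx, hx'⟩ ⟨hy, hy'⟩
        exact ⟨by simp [hx, hy], fun a => by rw [map_add, hx', hy', add_zero]⟩
      zero_mem' := by simp
      smul_mem' := by
        rintro c x ⟨hx, hx'⟩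
        exact ⟨by simp [hx], fun a => by rw [map_smul, hx', smul_zero]⟩ }
  have hMc : IsClosed (M : Set H) := by
    have : (M : Set H) = {ξ | π i ξ = 0} ∩ ⋂ a, {ξ | π (i * a) ξ = 0} := by
      ext ξ; simp [M]
    rw [this]
    exact (isClosed_eq (π i).continuous continuous_const).inter
      (isClosed_iInter fun a => isClosed_eq (π (i * a)).continuous continuous_const)
  have hMi : ∀ a : A, ∀ ξ ∈ M, π a ξ ∈ M := by
    rintro a ξ ⟨_, h2⟩
    refine ⟨?_, fun b => ?_⟩
    · simpa using h2 a
    · have := h2 (b * a)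
      rw [← mul_assoc, map_mul] at this
      exact this
  have hjM : ∀ ξ, π j ξ ∈ M := by
    intro ξ
    have key : ∀ x, x ∈ I → π x (π j ξ) = 0 := by
      intro x hx
      have h1 : x * j ∈ P := h ((TwoSidedIdeal.mem_inf A).2
        ⟨I.mul_mem_right x j hx, J.mul_mem_left x j hj⟩)
      have h2 := (hk _).1 h1
      rw [map_mul] at h2
      exact DFunLike.congr_fun h2 ξ
    exact ⟨key i hi, fun a => key _ (I.mul_mem_right i a hi)⟩
  rcases hπ.2 M hMc hMi with hM | hM
  · apply hj0
    ext ξ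
    have := hjM ξ
    rw [hM] at this
    simpa using this
  · apply hi0
    ext ξ
    have : ξ ∈ M := by rw [hM]; trivial
    exact this.1

/-- The hull of a two-sided ideal: the primitive ideals containing it. -/
def idealHull (I : TwoSidedIdeal A) : Set (PrimSpace A) := {P | I ≤ P.1}

/-- The hull-kernel (Jacobson) topology on `Prim(A)`: the closed sets are the hulls of ideals. -/
instance : TopologicalSpace (PrimSpace A) :=
  TopologicalSpace.ofClosed (Set.range idealHull)
    ⟨⊤, by
      ext P
      simpa [idealHull] using P.2.ne_top⟩
    (by
      intro S hS
      refine ⟨sSup {I | idealHull I ∈ S}, ?_⟩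
      ext P
      simp only [idealHull, Set.mem_ofPred_eq, sSup_le_iff, Set.mem_sInter]
      constructor
      · intro h t ht
        obtain ⟨I, rfl⟩ := hS ht
        exact h I ht
      · intro h I hI
        exact h _ hI)
    (by
      rintro _ ⟨I, rfl⟩ _ ⟨J, rfl⟩
      refine ⟨I ⊓ J, ?_⟩
      ext P
      constructor
      · exact fun h => P.2.prime h
      · rintro (h | h)
        · exact le_trans inf_le_left (show I ≤ P.1 from h)
        · exact le_trans inf_le_right (show J ≤ P.1 from h))

/-- `P ≈ Q`: no bounded continuous real function on `Prim(A)` separates `P` and `Q`. -/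
def primEquiv (P Q : PrimSpace A) : Prop := ∀ f : PrimSpace A →ᵇ ℝ, f P = f Q

/-- The kernel (intersection) of the equivalence class of `P`. -/
noncomputable def glimmIdeal (P : PrimSpace A) : TwoSidedIdeal A :=
  sInf {I | ∃ Q : PrimSpace A, primEquiv P Q ∧ Q.1 = I}

end PrimSpace

/-- `Glimm(A)`: the set of kernels of equivalence classes in `Prim(A)`. -/
def GlimmSpace (A : Type u) [NonUnitalCStarAlgebra A] : Type u :=
  {G : TwoSidedIdeal A // ∃ P : PrimSpace A, glimmIdeal P = G}

/-- The quotient map `q_A : Prim(A) → Glimm(A)`. -/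
noncomputable def glimmMap (A : Type u) [NonUnitalCStarAlgebra A] (P : PrimSpace A) :
    GlimmSpace A :=
  ⟨glimmIdeal P, P, rfl⟩

/-- The quotient topology on `Glimm(A)`. -/
@[reducible]
noncomputable def tauQ (A : Type u) [NonUnitalCStarAlgebra A] : TopologicalSpace (GlimmSpace A) :=
  TopologicalSpace.coinduced (glimmMap A) inferInstance

/-- The weakest topology on `Glimm(A)` making continuous all the functions `g` obtained by dropping
to `Glimm(A)` a bounded continuous real function `f` on `Prim(A)`, that is, `g ∘ q_A = f`. -/
@[reducible]
noncomputable def tauCR (A : Type u) [NonUnitalCStarAlgebra A] : TopologicalSpace (GlimmSpace A) :=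
  ⨅ (g : GlimmSpace A → ℝ) (_ : ∃ f : PrimSpace A →ᵇ ℝ, ∀ P, g (glimmMap A P) = f P),
    TopologicalSpace.induced g inferInstance

/-- The quotient norm `‖a + G‖` in `A / G`. -/
noncomputable def cosetNorm {A : Type u} [NonUnitalCStarAlgebra A] (a : A) (G : TwoSidedIdeal A) :
    ℝ :=
  ‖(QuotientAddGroup.mk a : A ⧸ AddSubgroup.ofClass G)‖

/-! ### Truncation by functional calculus -/

section Cutoff

/-! Given `a` and `α`, take for `C` the set of `P` with `‖a + P‖ ≥ α/2` and `q_A(P) ∈ K`. The norm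
condition cuts out a compact set (`isCompact_setOf_le_cosetNorm`), and the preimage of `K` is closed
because `τ_cr` is Hausdorff. `C` maps onto `K`: if every primitive ideal in the class of `G` had `‖a
+ Q‖ < α/2`, truncating `a` would give `d ∈ G` with `‖a + d‖ ≤ α/2`. Then `q_A`, being
`τ_q`-continuous, makes `K` `τ_q`-compact. Conversely, `P ↦ ‖a + P‖` is lower semicontinuous, so
each point of `C` has a neighbourhood where some `a` has norm at least 1; sums `a*a + b*b` merge
finitely many such elements, and passing from `P` to `q_A(P) ⊆ P` only increases the norm. The
compactness lemma rests on one existence result: if `a` has distance at least `β > 0` from an ideal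
`J`, possibly not closed, then an irreducible representation kills `J` and has norm at least `β` at
`a`. It comes from Hahn–Banach, Krein–Milman and GNS. -/

theorem exists_continuous_cutoff {t : ℝ} (ht : 0 < t) :
    ∃ g : ℝ → ℝ, Continuous g ∧ (∀ x ≤ t ^ 2, g x = 0) ∧
      ∀ x, 0 ≤ x → ‖x + x * g x + g x * x + g x * x * g x‖ ≤ t ^ 2 := by
  have hpos : ∀ x : ℝ, 0 < √(max x (t ^ 2)) := fun x =>
    Real.sqrt_pos.2 (lt_of_lt_of_le (by positivity) (le_max_right _ _))
  -- Chosen so that `x (1 + g x)² = min x t²` for `x ≥ 0`; the expanded form avoids the unit.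
  refine ⟨fun x => t / √(max x (t ^ 2)) - 1,
    (continuous_const.div (by fun_prop) fun x => (hpos x).ne').sub continuous_const,
    fun x hx => by simp [max_eq_right hx, Real.sqrt_sq ht.le, ht.ne'], fun x hx => ?_⟩
  have h : x + x * (t / √(max x (t ^ 2)) - 1) + (t / √(max x (t ^ 2)) - 1) * x
      + (t / √(max x (t ^ 2)) - 1) * x * (t / √(max x (t ^ 2)) - 1)
      = x * t ^ 2 / max x (t ^ 2) := by
    rw [← Real.sq_sqrt (le_trans hx (le_max_left x (t ^ 2))), mul_div_assoc, ← div_pow,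
      Real.sqrt_sq (hpos x).le]
    ring
  have hm : 0 < max x (t ^ 2) := Real.sqrt_pos.1 (hpos x)
  rw [h, Real.norm_of_nonneg (by positivity), div_le_iff₀ hm]
  nlinarith [le_max_left x (t ^ 2), sq_nonneg t]

/-- Every `a` can be moved into the ball of radius `t` by adding an element that is killed by all
representations `π` with `‖π a‖ ≤ t`. -/
theorem exists_norm_add_le_of_norm_map_le {A : Type*} [NonUnitalCStarAlgebra A] (a : A) {t : ℝ}
    (ht : 0 < t) : ∃ d : A, ‖a + d‖ ≤ t ∧ ∀ {B : Type u} [NonUnitalCStarAlgebra B]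
      (π : A →⋆ₙₐ[ℂ] B), ‖π a‖ ≤ t → π d = 0 := by
  obtain ⟨g, hgc, hg, hgt⟩ := exists_continuous_cutoff ht
  have hg0 : g 0 = 0 := hg 0 (by positivity)
  let := CStarAlgebra.spectralOrder A
  have := CStarAlgebra.spectralOrderedRing A
  have hh : IsSelfAdjoint (star a * a) := .star_mul_self a
  obtain ⟨k, hk⟩ : ∃ k, k = cfcₙ g (star a * a) := ⟨_, rfl⟩
  have hks : star k = k := by
    rw [hk]; exact (cfcₙ_predicate g (star a * a) : IsSelfAdjoint _).star_eq
  have hgco := hgc.continuousOn (s := quasispectrum ℝ (star a * a))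
  have hid : ContinuousOn (fun x : ℝ => x) (quasispectrum ℝ (star a * a)) := continuousOn_id
  -- Formally `a + a * k = a (1 + g(a*a))`, whose square `(·)*(·)` is `a*a` truncated at `t²`.
  refine ⟨a * k, ?_, ?_⟩
  · have hexp : star (a + a * k) * (a + a * k)
        = cfcₙ (fun x => x + x * g x + g x * x + g x * x * g x) (star a * a) := by
      have e1 : cfcₙ (fun x => x * g x) (star a * a) = star a * a * k := by
        rw [cfcₙ_mul _ _ _ hid rfl hgco hg0, cfcₙ_id' ℝ (star a * a), hk]
      have e2 : cfcₙ (fun x => g x * x) (star a * a) = k * (star a * a) := by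
        rw [cfcₙ_mul _ _ _ hgco hg0 hid rfl, cfcₙ_id' ℝ (star a * a), hk]
      have e3 : cfcₙ (fun x => g x * x * g x) (star a * a) = k * (star a * a) * k := by
        rw [cfcₙ_mul (fun x => g x * x) g _ (hgco.mul hid) (by simp) hgco hg0, e2, hk]
      rw [cfcₙ_add (fun x => x + x * g x + g x * x) (fun x => g x * x * g x) _
          ((hid.add (hid.mul hgco)).add (hgco.mul hid)) (by simp)
          ((hgco.mul hid).mul hgco) (by simp),
        cfcₙ_add (fun x => x + x * g x) (fun x => g x * x) _ (hid.add (hid.mul hgco)) (by simp)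
          (hgco.mul hid) (by simp),
        cfcₙ_add (fun x => x) (fun x => x * g x) _ hid rfl (hid.mul hgco) (by simp), e1, e2, e3,
        cfcₙ_id' ℝ (star a * a)]
      simp only [star_add, star_mul, hks]
      noncomm_ring
    have hle : ‖a + a * k‖ * ‖a + a * k‖ ≤ t ^ 2 := by
      rw [← CStarRing.norm_star_mul_self, hexp]
      exact norm_cfcₙ_le fun x hx =>
        hgt x (quasispectrum_nonneg_of_nonneg _ (star_mul_self_nonneg a) x hx)
    exact le_of_sq_le_sq (by rwa [sq]) ht.le
  · intro B _ π hπ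
    have hc : Continuous π :=
      AddMonoidHomClass.continuous_of_bound π 1 (by
        simpa only [one_mul] using NonUnitalStarAlgHom.norm_apply_le π)
    have h1 : π k = cfcₙ g (star (π a) * π a) := by
      rw [hk, NonUnitalStarAlgHomClass.map_cfcₙ π g (star a * a) hgco hg0 hc hh
          (by rw [map_mul, map_star]; exact .star_mul_self _),
        map_mul, map_star]
    have h2 : cfcₙ g (star (π a) * π a) = 0 := by
      rw [← cfcₙ_const_zero ℝ (star (π a) * π a)]
      refine cfcₙ_congr fun x hx => hg x ?_
      have h3 := NonUnitalIsometricContinuousFunctionalCalculus.norm_quasispectrum_le _ hx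
      rw [CStarRing.norm_star_mul_self] at h3
      have h4 := (le_abs_self x).trans h3
      nlinarith [norm_nonneg (π a)]
    rw [map_mul, h1, h2, mul_zero]

end Cutoff

/-! ### Norm estimates modulo an ideal that need not be closed -/

section IdealCut

variable {B : Type*} [CStarAlgebra B]

/-- Take `r = f(j)` with `f x = ε² / (ε² + x²)`. Since `1 - f` is divisible by `x`, `1 - r` is a
multiple of `j` and lies in `J` without any closure; and `|x f(x)²| ≤ |x f(x)| ≤ ε`. -/
theorem exists_sub_mem_and_norm_conjugate_le {J : Submodule ℂ B}
    (hr : ∀ j ∈ J, ∀ b, j * b ∈ J) {j : B} (hj : j ∈ J) (hjs : IsSelfAdjoint j) {ε : ℝ}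
    (hε : 0 < ε) :
    ∃ r : B, IsSelfAdjoint r ∧ 1 - r ∈ J ∧ ‖r‖ ≤ 1 ∧ ‖r * j * r‖ ≤ ε := by
  let f : ℝ → ℝ := fun x => ε ^ 2 / (ε ^ 2 + x ^ 2)
  have hden : ∀ x : ℝ, 0 < ε ^ 2 + x ^ 2 := fun x => by positivity
  have hf : Continuous f := continuous_const.div (by fun_prop) fun x => (hden x).ne'
  have hg : Continuous fun x : ℝ => x / (ε ^ 2 + x ^ 2) :=
    continuous_id.div (by fun_prop) fun x => (hden x).ne'
  have hf0 : ∀ x, 0 ≤ f x := fun x => by positivity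
  have hf1 : ∀ x, f x ≤ 1 := fun x => by
    rw [div_le_one (hden x)]; nlinarith [sq_nonneg x]
  refine ⟨cfc f j, cfc_predicate f j, ?_, ?_, ?_⟩
  · have : 1 - cfc f j = j * cfc (fun x : ℝ => x / (ε ^ 2 + x ^ 2)) j := by
      rw [← cfc_one ℝ j, ← cfc_sub (R := ℝ) 1 f j continuousOn_const hf.continuousOn]
      conv_rhs => enter [1]; rw [← cfc_id' ℝ j]
      rw [← cfc_mul (R := ℝ) (fun x => x) _ j continuousOn_id hg.continuousOn]
      refine cfc_congr fun x _ => ?_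
      have := (hden x).ne'
      simp only [f, Pi.one_apply]
      field_simp
      ring
    rw [this]
    exact hr j hj _
  · refine norm_cfc_le zero_le_one fun x _ => ?_
    rw [Real.norm_of_nonneg (hf0 x)]
    exact hf1 x
  · have : cfc f j * j * cfc f j = cfc (fun x => f x * x * f x) j := by
      rw [cfc_mul (R := ℝ) _ _ j (by fun_prop) hf.continuousOn,
        cfc_mul (R := ℝ) f (fun x => x) j hf.continuousOn continuousOn_id, cfc_id' ℝ j]
    rw [this]
    refine norm_cfc_le hε.le fun x _ => ?_
    have h1 : ‖f x * x * f x‖ ≤ ‖f x * x‖ * 1 := by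
      rw [norm_mul]
      gcongr
      rw [Real.norm_of_nonneg (hf0 x)]
      exact hf1 x
    refine h1.trans ?_
    rw [mul_one, norm_mul, Real.norm_of_nonneg (hf0 x), Real.norm_eq_abs, div_mul_eq_mul_div,
      div_le_iff₀ (hden x)]
    nlinarith [sq_nonneg (ε - |x|), sq_abs x, abs_nonneg x, mul_nonneg hε.le (abs_nonneg x)]

/-- Compressing the inequality by `r` makes the `j` term negligible, so `‖a r‖² ≤ c + ε`, while `a r
= a - a (1 - r)` represents `a` modulo `J`. -/
theorem sq_le_of_star_mul_self_add_le [PartialOrder B] [StarOrderedRing B] {J : Submodule ℂ B}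
    (hl : ∀ j ∈ J, ∀ b, b * j ∈ J) (hr : ∀ j ∈ J, ∀ b, j * b ∈ J) {a : B} {β : ℝ} (hβ : 0 ≤ β)
    (ha : ∀ j ∈ J, β ≤ ‖a + j‖) {j : B} (hj : j ∈ J) (hjs : IsSelfAdjoint j) {c : ℝ} (hc : 0 ≤ c)
    (h : star a * a + j ≤ algebraMap ℝ B c) : β ^ 2 ≤ c := by
  refine le_of_forall_pos_le_add fun ε hε => ?_
  obtain ⟨r, hrs, hrJ, hr1, hrj⟩ := exists_sub_mem_and_norm_conjugate_le hr hj hjs hε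
  have h1 : r * (star a * a) * r ≤ r * (algebraMap ℝ B c - j) * r := by
    have := star_left_conjugate_le_conjugate (le_sub_iff_add_le.2 h) r
    rwa [hrs.star_eq] at this
  have h2 : star (a * r) * (a * r) = r * (star a * a) * r := by
    rw [star_mul, hrs.star_eq]; noncomm_ring
  have h3 : ‖a * r‖ * ‖a * r‖ ≤ c + ε := by
    rw [← CStarRing.norm_star_mul_self, h2]
    refine (CStarAlgebra.norm_le_norm_of_nonneg_of_le (h2 ▸ star_mul_self_nonneg _) h1).trans ?_
    have h4 : r * (algebraMap ℝ B c - j) * r = c • (r * r) - r * j * r := by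
      rw [Algebra.algebraMap_eq_smul_one, mul_sub, sub_mul]; simp
    rw [h4]
    refine (norm_sub_le _ _).trans (add_le_add ?_ hrj)
    rw [norm_smul, Real.norm_of_nonneg hc]
    refine mul_le_of_le_one_right hc ((norm_mul_le _ _).trans ?_)
    exact mul_le_one₀ hr1 (norm_nonneg _) hr1
  have h5 : β ≤ ‖a * r‖ := by
    have := ha (-(a * (1 - r))) (J.neg_mem (hl _ hrJ a))
    rwa [mul_sub, mul_one, neg_sub, add_sub_cancel] at this
  nlinarith

end IdealCut

/-! ### States and extreme states vanishing on an ideal -/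

section PureStates

open scoped ComplexOrder ComplexStarModule InnerProductSpace

variable {B : Type*} [CStarAlgebra B]

section Order

variable [PartialOrder B] [StarOrderedRing B]

/-- The states of `B` vanishing on the self-adjoint elements of `J`. -/
def statesVanishingOn (J : Submodule ℂ B) : Set (WeakDual ℂ B) :=
  {φ | (∀ x, 0 ≤ x → 0 ≤ φ x) ∧ φ 1 = 1 ∧ ∀ j ∈ J, IsSelfAdjoint j → φ j = 0}

/-- The elements dominated by a real number below `r` modulo the self-adjoint elements of `J`. -/
def dominatedModulo (J : Submodule ℂ B) (r : ℝ) : Set B :=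
  {x | ∃ j ∈ J, IsSelfAdjoint j ∧ ∃ c < r, (ℜ x : B) + j ≤ algebraMap ℝ B c}

theorem convex_dominatedModulo (J : Submodule ℂ B) (r : ℝ) : Convex ℝ (dominatedModulo J r) := by
  rintro x ⟨j, hj, hjs, c, hc, hx⟩ y ⟨k, hk, hks, d, hd, hy⟩ s t hs ht hst
  refine ⟨s • j + t • k, J.add_mem (J.smul_of_tower_mem s hj) (J.smul_of_tower_mem t hk),
    ((IsSelfAdjoint.all s).smul hjs).add ((IsSelfAdjoint.all t).smul hks), s * c + t * d, ?_, ?_⟩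
  · rcases hs.eq_or_lt with rfl | hs
    · simp_all
    · nlinarith [mul_lt_mul_of_pos_left hc hs, mul_le_mul_of_nonneg_left hd.le ht,
        congrArg (r * ·) hst]
  · have := add_le_add (smul_le_smul_of_nonneg_left hx hs) (smul_le_smul_of_nonneg_left hy ht)
    refine le_trans (le_of_eq ?_) (this.trans (le_of_eq ?_))
    · simp only [map_add, map_smul, AddSubgroup.coe_add, selfAdjoint.val_smul, smul_add]
      abel
    · simp only [Algebra.algebraMap_eq_smul_one, smul_smul, add_smul]

theorem isOpen_dominatedModulo (J : Submodule ℂ B) (r : ℝ) : IsOpen (dominatedModulo J r) := by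
  rw [Metric.isOpen_iff]
  rintro x ⟨j, hj, hjs, c, hc, hx⟩
  refine ⟨(r - c) / 2, by linarith, fun y hy => ⟨j, hj, hjs, c + (r - c) / 2, by linarith, ?_⟩⟩
  rw [mem_ball_iff_norm] at hy
  have h1 : (ℜ (y - x) : B) ≤ algebraMap ℝ B ((r - c) / 2) :=
    (IsSelfAdjoint.le_algebraMap_norm_self (ℜ (y - x)).2).trans
      (algebraMap_mono B ((realPart.norm_le _).trans hy.le))
  have := add_le_add hx h1
  rw [← map_add] at this
  refine le_trans (le_of_eq ?_) this
  simp only [map_sub, AddSubgroup.coe_sub]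
  abel

/-- Supplies rays in the convex set: a functional bounded above there is nonpositive along them. -/
theorem smul_mem_dominatedModulo {J : Submodule ℂ B} {r : ℝ} (hr : 0 < r) {x j : B} (hj : j ∈ J)
    (hjs : IsSelfAdjoint j) (h : (ℜ x : B) + j ≤ 0) {t : ℝ} (ht : 0 ≤ t) :
    t • x ∈ dominatedModulo J r := by
  refine ⟨t • j, J.smul_of_tower_mem t hj, (IsSelfAdjoint.all t).smul hjs, 0, hr, ?_⟩
  have := smul_le_smul_of_nonneg_left h ht
  simpa using this

theorem nonpos_of_forall_mul_lt {x y : ℝ} (h : ∀ t : ℝ, 0 ≤ t → t * x < y) : x ≤ 0 := by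
  by_contra! hx
  have := h (|y| / x) (by positivity)
  rw [div_mul_cancel₀ _ hx.ne'] at this
  exact (le_abs_self y).not_gt this

/-- Hahn–Banach separates `star a * a` from the open convex set `dominatedModulo J (β ^ 2)`; the
separating functional, divided by its value at 1, is the state. -/
theorem exists_mem_statesVanishingOn {J : Submodule ℂ B} (hl : ∀ j ∈ J, ∀ b, b * j ∈ J)
    (hr : ∀ j ∈ J, ∀ b, j * b ∈ J) {a : B} {β : ℝ} (hβ : 0 < β) (ha : ∀ j ∈ J, β ≤ ‖a + j‖) :
    ∃ φ ∈ statesVanishingOn J, β ^ 2 ≤ (φ (star a * a)).re := by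
  have hβ2 : 0 < β ^ 2 := by positivity
  have hns : star a * a ∉ dominatedModulo J (β ^ 2) := by
    rintro ⟨j, hj, hjs, c, hc, h⟩
    rw [(IsSelfAdjoint.star_mul_self a).coe_realPart] at h
    refine (max_lt hc hβ2).not_ge (sq_le_of_star_mul_self_add_le hl hr hβ.le ha hj hjs
      (le_max_right c 0) (h.trans (algebraMap_mono B (le_max_left c 0))))
  obtain ⟨f, hf⟩ := RCLike.geometric_hahn_banach_open_point (𝕜 := ℂ)
    (convex_dominatedModulo J (β ^ 2)) (isOpen_dominatedModulo J (β ^ 2)) hns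
  simp only [RCLike.re_to_complex] at hf
  have key : ∀ {x j : B}, j ∈ J → IsSelfAdjoint j → (ℜ x : B) + j ≤ 0 → (f x).re ≤ 0 := by
    intro x j hj hjs h
    refine nonpos_of_forall_mul_lt (y := (f (star a * a)).re) fun t ht => ?_
    have := hf _ (smul_mem_dominatedModulo hβ2 hj hjs h ht)
    rwa [← Complex.coe_smul, map_smul, smul_eq_mul, Complex.re_ofReal_mul] at this
  -- Both `i x` and `-i x` have zero real part, so `key` applies to each.
  have him : ∀ x : B, IsSelfAdjoint x → (f x).im = 0 := by
    intro x hx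
    have hre : ∀ c : ℂ, c.re = 0 → (ℜ (c • x) : B) + 0 ≤ 0 := fun c hc => by
      rw [realPart_smul, hc, hx.imaginaryPart]; simp
    have h1 := key J.zero_mem (.zero _) (hre Complex.I (by simp))
    have h2 := key J.zero_mem (.zero _) (hre (-Complex.I) (by simp))
    simp only [map_smul, smul_eq_mul, Complex.mul_re, Complex.neg_re, Complex.neg_im,
      Complex.I_re, Complex.I_im] at h1 h2
    linarith
  have hpos : ∀ x : B, 0 ≤ x → 0 ≤ (f x).re := by
    intro x hx
    have := key (x := -x) J.zero_mem (.zero _) (by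
      rw [(IsSelfAdjoint.of_nonneg hx).neg.coe_realPart]; simpa using hx)
    simpa using this
  have hzero : ∀ j ∈ J, IsSelfAdjoint j → (f j).re = 0 := by
    intro j hj hjs
    have h1 := key (x := j) (J.neg_mem hj) hjs.neg (by rw [hjs.coe_realPart]; simp)
    have h2 := key (x := -j) hj hjs (by rw [hjs.neg.coe_realPart]; simp)
    simp only [map_neg, Complex.neg_re] at h2
    linarith
  have hreal : ∀ (c : ℝ), (f (algebraMap ℝ B c)).re = c * (f 1).re := fun c => by
    rw [Algebra.algebraMap_eq_smul_one, ← Complex.coe_smul, map_smul, smul_eq_mul,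
      Complex.re_ofReal_mul]
  have hh : 0 < (f (star a * a)).re := by
    have := hf 0 ⟨0, J.zero_mem, .zero _, 0, hβ2, by simp⟩
    simpa using this
  have hone : 0 < (f 1).re := by
    refine (hpos 1 zero_le_one).lt_of_ne fun h0 => ?_
    have h1 := hpos _ (sub_nonneg.2
      (IsSelfAdjoint.le_algebraMap_norm_self (IsSelfAdjoint.star_mul_self a)))
    rw [map_sub, Complex.sub_re, hreal, ← h0] at h1
    linarith
  -- Scalars below `β²` lie in the separated set.
  have hge : β ^ 2 * (f 1).re ≤ (f (star a * a)).re := by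
    refine le_of_forall_lt fun y hy => ?_
    have h1 : y / (f 1).re < β ^ 2 := by rwa [div_lt_iff₀ hone]
    have := hf (algebraMap ℝ B (y / (f 1).re)) ⟨0, J.zero_mem, .zero _, y / (f 1).re, h1, by
      rw [(IsSelfAdjoint.algebraMap B (IsSelfAdjoint.all _)).coe_realPart, add_zero]⟩
    rwa [hreal, div_mul_cancel₀ _ hone.ne'] at this
  have hval : ∀ x : B, IsSelfAdjoint x → f x = ((f x).re : ℂ) := fun x hx =>
    Complex.ext (by simp) (by simp [him x hx])
  let φ : WeakDual ℂ B := StrongDual.toWeakDual (((f 1).re⁻¹ : ℂ) • f)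
  have hφ : ∀ x, φ x = ((f 1).re⁻¹ : ℂ) * f x := fun x => rfl
  refine ⟨φ, ⟨fun x hx => ?_, ?_, fun j hj hjs => ?_⟩, ?_⟩
  · rw [hφ, hval x (.of_nonneg hx)]
    exact_mod_cast mul_nonneg (inv_nonneg.2 hone.le) (hpos x hx)
  · rw [hφ, hval 1 (.one _)]
    exact_mod_cast inv_mul_cancel₀ hone.ne'
  · rw [hφ, hval j hjs, hzero j hj hjs]; simp
  · rw [hφ, ← Complex.ofReal_inv, Complex.re_ofReal_mul, inv_mul_eq_div, le_div_iff₀ hone]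
    exact hge

/-- Banach–Alaoglu; the radius 4 comes from writing `x` as a combination of four positive elements
of norm at most `‖x‖`. -/
theorem isCompact_statesVanishingOn (J : Submodule ℂ B) :
    IsCompact (statesVanishingOn J) := by
  refine (WeakDual.isCompact_closedBall (𝕜 := ℂ) (E := B) 0 4).of_isClosed_subset ?_ ?_
  · have : statesVanishingOn J = (⋂ x, ⋂ (_ : 0 ≤ x), {φ : WeakDual ℂ B | 0 ≤ φ x}) ∩
        ({φ : WeakDual ℂ B | φ 1 = 1} ∩
          ⋂ j ∈ J, ⋂ (_ : IsSelfAdjoint j), {φ : WeakDual ℂ B | φ j = 0}) := by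
      ext φ; simp [statesVanishingOn]
    rw [this]
    refine .inter (isClosed_iInter fun x => isClosed_iInter fun _ =>
      isClosed_le continuous_const (WeakDual.eval_continuous x)) (.inter
      (isClosed_eq (WeakDual.eval_continuous 1) continuous_const) ?_)
    exact isClosed_iInter fun j => isClosed_iInter fun _ => isClosed_iInter fun _ =>
      isClosed_eq (WeakDual.eval_continuous j) continuous_const
  · rintro φ ⟨hpos, hone, -⟩
    have hp : ∀ x, 0 ≤ x → ‖φ x‖ ≤ ‖x‖ := by
      intro x hx
      have := (PositiveLinearMap.mk₀ (φ : B →ₗ[ℂ] ℂ) hpos).norm_apply_le_of_nonneg x hx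
      change ‖φ x‖ ≤ ‖φ 1‖ * ‖x‖ at this
      simpa [hone] using this
    rw [Set.mem_preimage, mem_closedBall_zero_iff]
    refine ContinuousLinearMap.opNorm_le_bound _ (by norm_num) fun x => ?_
    obtain ⟨y, hy, hyn, hx⟩ := CStarAlgebra.exists_sum_four_nonneg x
    change ‖φ x‖ ≤ _
    conv_lhs => rw [hx]
    simp only [map_sum, map_smul]
    refine (norm_sum_le _ _).trans ?_
    simp only [norm_smul, norm_pow, Complex.norm_I, one_pow, one_mul]
    refine (Finset.sum_le_sum (g := fun _ => ‖x‖) fun i _ =>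
      (hp _ (hy i)).trans (hyn i)).trans (by simp)

/-- The states maximizing the value at `star a * a` form a compact exposed face, and an extreme
point of a face is extreme in the whole set. -/
theorem exists_mem_extremePoints_statesVanishingOn {J : Submodule ℂ B}
    (hl : ∀ j ∈ J, ∀ b, b * j ∈ J) (hr : ∀ j ∈ J, ∀ b, j * b ∈ J) {a : B} {β : ℝ} (hβ : 0 < β)
    (ha : ∀ j ∈ J, β ≤ ‖a + j‖) :
    ∃ φ ∈ (statesVanishingOn J).extremePoints ℝ, β ^ 2 ≤ (φ (star a * a)).re := by
  obtain ⟨φ₀, hφ₀, hge⟩ := exists_mem_statesVanishingOn hl hr hβ ha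
  let l : StrongDual ℝ (WeakDual ℂ B) :=
    { toFun := fun φ => (φ (star a * a)).re
      map_add' := fun φ ψ => Complex.add_re _ _
      map_smul' := fun t φ => Complex.re_ofReal_mul t _
      cont := Complex.continuous_re.comp (WeakDual.eval_continuous (star a * a)) }
  have hS := isCompact_statesVanishingOn J
  have hexp : IsExposed ℝ (statesVanishingOn J) (l.toExposed (statesVanishingOn J)) :=
    ContinuousLinearMap.toExposed.isExposed
  have : LocallyConvexSpace ℝ (WeakDual ℂ B) := WeakBilin.locallyConvexSpace
  obtain ⟨ψ, hψ, hmax⟩ := hS.exists_isMaxOn ⟨φ₀, hφ₀⟩ l.continuous.continuousOn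
  obtain ⟨φ, hφ⟩ := (hexp.isCompact hS).extremePoints_nonempty ⟨ψ, hψ, fun y hy => hmax hy⟩
  exact ⟨φ, hexp.isExtreme.extremePoints_subset_extremePoints hφ,
    hge.trans (hφ.1.2 φ₀ hφ₀)⟩

end Order

end PureStates

/-! ### From extreme states to irreducible representations -/

section Irreducible

open scoped ComplexOrder InnerProductSpace

variable {B : Type*} [CStarAlgebra B] {H : Type*} [NormedAddCommGroup H] [InnerProductSpace ℂ H]
  [CompleteSpace H]

/-- The functional `b ↦ ⟪v, π b v⟫`. -/
noncomputable def vectorFunctional (π : B →⋆ₐ[ℂ] (H →L[ℂ] H)) (v : H) : WeakDual ℂ B :=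
  StrongDual.toWeakDual <| LinearMap.mkContinuous
    ((innerSL ℂ v).toLinearMap ∘ₗ (ContinuousLinearMap.apply ℂ H v).toLinearMap ∘ₗ
      π.toAlgHom.toLinearMap) (‖v‖ * ‖v‖) fun b => by
    change ‖⟪v, π b v⟫_ℂ‖ ≤ _
    calc ‖⟪v, π b v⟫_ℂ‖ ≤ ‖v‖ * (‖π b‖ * ‖v‖) :=
          (norm_inner_le_norm _ _).trans (by gcongr; exact (π b).le_opNorm v)
      _ ≤ ‖v‖ * (‖b‖ * ‖v‖) := by gcongr; exact NonUnitalStarAlgHom.norm_apply_le π b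
      _ = ‖v‖ * ‖v‖ * ‖b‖ := by ring

theorem vectorFunctional_apply (π : B →⋆ₐ[ℂ] (H →L[ℂ] H)) (v : H) (b : B) :
    vectorFunctional π v b = ⟪v, π b v⟫_ℂ := rfl

theorem inner_map_star_left (π : B →⋆ₐ[ℂ] (H →L[ℂ] H)) (b : B) (v w : H) :
    ⟪π (star b) v, w⟫_ℂ = ⟪v, π b w⟫_ℂ := by
  rw [map_star, ContinuousLinearMap.star_eq_adjoint, ContinuousLinearMap.adjoint_inner_left]

theorem smul_vectorFunctional_mem_statesVanishingOn [PartialOrder B] [StarOrderedRing B]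
    {J : Submodule ℂ B} (π : B →⋆ₐ[ℂ] (H →L[ℂ] H)) (hJ : ∀ j ∈ J, π j = 0) {v : H} (hv : v ≠ 0) :
    (‖v‖ ^ 2)⁻¹ • vectorFunctional π v ∈ statesVanishingOn J := by
  have hv' : ‖v‖ ^ 2 ≠ 0 := by simpa using hv
  have happ : ∀ b, ((‖v‖ ^ 2)⁻¹ • vectorFunctional π v) b
      = (((‖v‖ ^ 2)⁻¹ : ℝ) : ℂ) * ⟪v, π b v⟫_ℂ := fun b => rfl
  refine ⟨fun x hx => ?_, ?_, fun j hj _ => ?_⟩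
  · rw [happ]
    refine mul_nonneg (by exact_mod_cast inv_nonneg.2 (sq_nonneg _)) ?_
    obtain ⟨y, rfl⟩ := CStarAlgebra.nonneg_iff_eq_star_mul_self.1 hx
    rw [map_mul, mul_apply_eq_comp, ← inner_map_star_left, star_star,
      inner_self_eq_norm_sq_to_K]
    norm_cast
    positivity
  · rw [happ, map_one, one_apply_eq_self, inner_self_eq_norm_sq_to_K]
    change (((‖v‖ ^ 2)⁻¹ : ℝ) : ℂ) * (‖v‖ : ℂ) ^ 2 = 1
    exact_mod_cast inv_mul_cancel₀ hv'
  · rw [happ, hJ j hj]; simp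

theorem eq_top_of_mem_of_denseRange (π : B →⋆ₐ[ℂ] (H →L[ℂ] H)) {ξ : H}
    (hξ : DenseRange fun b => π b ξ) {M : Submodule ℂ H} (hM : IsClosed (M : Set H))
    (hMi : ∀ b, ∀ v ∈ M, π b v ∈ M) (h : ξ ∈ M) : M = ⊤ := by
  refine eq_top_iff.2 fun v _ => ?_
  have : closure (Set.range fun b => π b ξ) ⊆ M :=
    closure_minimal (by rintro _ ⟨b, rfl⟩; exact hMi b ξ h) hM
  exact this (hξ v)

/-- The cyclic representation attached to an extreme state is irreducible. -/
theorem eq_bot_or_eq_top_of_mem_extremePoints [PartialOrder B] [StarOrderedRing B]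
    {J : Submodule ℂ B} (π : B →⋆ₐ[ℂ] (H →L[ℂ] H)) (hJ : ∀ j ∈ J, π j = 0) {ξ : H}
    (hξ : DenseRange fun b => π b ξ)
    (hφ : vectorFunctional π ξ ∈ (statesVanishingOn J).extremePoints ℝ)
    {M : Submodule ℂ H} (hM : IsClosed (M : Set H)) (hMi : ∀ b, ∀ v ∈ M, π b v ∈ M) :
    M = ⊥ ∨ M = ⊤ := by
  have : CompleteSpace M := hM.completeSpace_coe
  have hMi' : ∀ b, ∀ v ∈ Mᗮ, π b v ∈ Mᗮ := fun b v hv => by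
    rw [Submodule.mem_orthogonal]
    intro w hw
    rw [← inner_map_star_left]
    exact (Submodule.mem_orthogonal _ _).1 hv _ (hMi _ w hw)
  obtain ⟨η, hη, ζ, hζ, hadd⟩ := M.exists_add_mem_mem_orthogonal ξ
  rcases eq_or_ne η 0 with h0 | hη0
  · left
    have : Mᗮ = ⊤ := eq_top_of_mem_of_denseRange π hξ M.isClosed_orthogonal hMi' (by
      rw [hadd, h0, zero_add]; exact hζ)
    rwa [Submodule.orthogonal_eq_top_iff] at this
  right
  rcases eq_or_ne ζ 0 with h0 | hζ0
  · exact eq_top_of_mem_of_denseRange π hξ hM hMi (by rw [hadd, h0, add_zero]; exact hη)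
  have hort : ∀ u ∈ M, ∀ w ∈ Mᗮ, ⟪u, w⟫_ℂ = 0 := fun u hu w hw => hw u hu
  have hort' : ∀ u ∈ M, ∀ w ∈ Mᗮ, ⟪w, u⟫_ℂ = 0 := fun u hu w hw =>
    inner_eq_zero_symm.1 (hw u hu)
  have hone : ‖η‖ ^ 2 + ‖ζ‖ ^ 2 = 1 := by
    have h1 : ‖ξ‖ ^ 2 = 1 := by
      have := hφ.1.2.1
      rw [vectorFunctional_apply, map_one, one_apply_eq_self,
        inner_self_eq_norm_sq_to_K] at this
      change (‖ξ‖ : ℂ) ^ 2 = 1 at this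
      exact_mod_cast this
    rw [← h1, hadd, sq, sq, sq,
      norm_add_sq_eq_norm_sq_add_norm_sq_of_inner_eq_zero _ _ (hort η hη ζ hζ)]
  have hη2 : 0 < ‖η‖ ^ 2 := by positivity
  have hζ2 : 0 < ‖ζ‖ ^ 2 := by positivity
  -- `M` and its complement are invariant, so the cross terms vanish and the state of `ξ` is a
  -- convex combination of the normalized states of `η` and `ζ`.
  have hseg : vectorFunctional π ξ ∈ openSegment ℝ ((‖η‖ ^ 2)⁻¹ • vectorFunctional π η)
      ((‖ζ‖ ^ 2)⁻¹ • vectorFunctional π ζ) := by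
    refine ⟨‖η‖ ^ 2, ‖ζ‖ ^ 2, hη2, hζ2, hone, ?_⟩
    refine DFunLike.ext _ _ fun b => ?_
    change ((‖η‖ ^ 2 : ℝ) : ℂ) * ((((‖η‖ ^ 2)⁻¹ : ℝ) : ℂ) * ⟪η, π b η⟫_ℂ)
      + ((‖ζ‖ ^ 2 : ℝ) : ℂ) * ((((‖ζ‖ ^ 2)⁻¹ : ℝ) : ℂ) * ⟪ζ, π b ζ⟫_ℂ) = ⟪ξ, π b ξ⟫_ℂ
    have hcancel : ∀ (r : ℝ) (z : ℂ), 0 < r → (r : ℂ) * (((r⁻¹ : ℝ) : ℂ) * z) = z := fun r z hr => by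
      rw [Complex.ofReal_inv, mul_inv_cancel_left₀ (by exact_mod_cast hr.ne')]
    rw [hcancel _ _ hη2, hcancel _ _ hζ2, hadd, map_add, inner_add_left, inner_add_right,
      inner_add_right, hort η hη _ (hMi' b ζ hζ), hort' _ (hMi b η hη) ζ hζ]
    ring
  have heq := hφ.2 (smul_vectorFunctional_mem_statesVanishingOn π hJ hη0)
    (smul_vectorFunctional_mem_statesVanishingOn π hJ hζ0) hseg
  -- By extremality the two states agree, so `η - ‖η‖² ξ` is orthogonal to a dense orbit; hence `ξ`
  -- is a multiple of `η ∈ M`.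
  have hinner : ∀ b, ⟪π b ξ, η - ((‖η‖ ^ 2 : ℝ) : ℂ) • ξ⟫_ℂ = 0 := by
    intro b
    have h1 : (((‖η‖ ^ 2)⁻¹ : ℝ) : ℂ) * ⟪η, π (star b) η⟫_ℂ = ⟪ξ, π (star b) ξ⟫_ℂ :=
      DFunLike.congr_fun heq (star b)
    have h2 : ⟪ξ, π (star b) η⟫_ℂ = ⟪η, π (star b) η⟫_ℂ := by
      rw [hadd, inner_add_left, hort' _ (hMi _ η hη) ζ hζ, add_zero]
    have h3 : ((‖η‖ ^ 2 : ℝ) : ℂ) ≠ 0 := by exact_mod_cast hη2.ne'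
    have h4 := inner_map_star_left π (star b)
    rw [star_star] at h4
    rw [inner_sub_right, inner_smul_right, h4, h4, h2, ← h1, Complex.ofReal_inv,
      mul_inv_cancel_left₀ h3, sub_self]
  have hzero : η - ((‖η‖ ^ 2 : ℝ) : ℂ) • ξ = 0 := by
    refine hξ.induction_on (p := fun v => ⟪v, η - ((‖η‖ ^ 2 : ℝ) : ℂ) • ξ⟫_ℂ = 0)
      (η - ((‖η‖ ^ 2 : ℝ) : ℂ) • ξ) (isClosed_eq (by fun_prop) continuous_const) hinner |>
      inner_self_eq_zero.1
  refine eq_top_of_mem_of_denseRange π hξ hM hMi ?_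
  have h3 : ((‖η‖ ^ 2 : ℝ) : ℂ) ≠ 0 := by exact_mod_cast hη2.ne'
  rw [sub_eq_zero] at hzero
  exact (M.smul_mem_iff h3).1 (hzero ▸ hη)

theorem gnsStarAlgHom_apply_one [PartialOrder B] [StarOrderedRing B] (f : B →ₚ[ℂ] ℂ) (b : B) :
    f.gnsStarAlgHom b (f.toPreGNS 1 : f.GNS) = (f.toPreGNS b : f.GNS) := by
  simp

theorem gns_inner [PartialOrder B] [StarOrderedRing B] (f : B →ₚ[ℂ] ℂ) (b c : B) :
    ⟪(f.toPreGNS b : f.GNS), (f.toPreGNS c : f.GNS)⟫_ℂ = f (star b * c) := by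
  rw [UniformSpace.Completion.inner_coe, f.preGNS_inner_def]; rfl

end Irreducible

open scoped ComplexOrder in
/-- If `a` has distance at least `β` from a two-sided ideal `J`, then some irreducible
representation kills `J` and has norm at least `β` at `a`. -/
theorem exists_irreducible_of_le_norm_add {B : Type u} [CStarAlgebra B]
    {J : Submodule ℂ B} (hl : ∀ j ∈ J, ∀ b, b * j ∈ J) (hr : ∀ j ∈ J, ∀ b, j * b ∈ J) {a : B}
    {β : ℝ} (hβ : 0 < β) (ha : ∀ j ∈ J, β ≤ ‖a + j‖) :
    ∃ (H : Type u) (_ : NormedAddCommGroup H) (_ : InnerProductSpace ℂ H) (_ : CompleteSpace H)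
      (π : B →⋆ₐ[ℂ] (H →L[ℂ] H)), (∀ M : Submodule ℂ H, IsClosed (M : Set H) →
        (∀ b, ∀ v ∈ M, π b v ∈ M) → M = ⊥ ∨ M = ⊤) ∧ (∀ j ∈ J, π j = 0) ∧ β ≤ ‖π a‖ := by
  let := CStarAlgebra.spectralOrder B
  have := CStarAlgebra.spectralOrderedRing B
  obtain ⟨φ, hφ, hge⟩ := exists_mem_extremePoints_statesVanishingOn hl hr hβ ha
  let f : B →ₚ[ℂ] ℂ := PositiveLinearMap.mk₀ (φ : B →ₗ[ℂ] ℂ) hφ.1.1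
  have hf : ∀ b, f b = φ b := fun b => rfl
  let ξ : f.GNS := (f.toPreGNS 1 : f.GNS)
  have hπξ : ∀ b, f.gnsStarAlgHom b ξ = (f.toPreGNS b : f.GNS) := gnsStarAlgHom_apply_one f
  have hdense : DenseRange fun b => f.gnsStarAlgHom b ξ := by
    simp_rw [hπξ]
    exact UniformSpace.Completion.denseRange_coe.comp f.toPreGNS.surjective.denseRange
      (UniformSpace.Completion.continuous_coe _)
  have hvec : vectorFunctional f.gnsStarAlgHom ξ = φ := by
    refine DFunLike.ext _ _ fun b => ?_
    rw [vectorFunctional_apply, hπξ, gns_inner, star_one, one_mul, hf]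
  have hJ : ∀ j ∈ J, f.gnsStarAlgHom j = 0 := by
    intro j hj
    refine ContinuousLinearMap.ext fun v => ?_
    refine hdense.induction_on (p := fun v => f.gnsStarAlgHom j v = 0) v
      (isClosed_eq (ContinuousLinearMap.continuous _) continuous_const) fun b => ?_
    -- The squared norm is `φ((jb)*(jb))`, the value at a self-adjoint element of `J`.
    rw [← mul_apply_eq_comp, ← map_mul, hπξ, ← inner_self_eq_zero (𝕜 := ℂ),
      gns_inner, hf]
    refine hφ.1.2.2 _ (hl _ (hr _ hj b) _) (.star_mul_self _)
  refine ⟨f.GNS, inferInstance, inferInstance, inferInstance, f.gnsStarAlgHom,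
    fun M hM hMi => eq_bot_or_eq_top_of_mem_extremePoints f.gnsStarAlgHom hJ hdense
      (hvec ▸ hφ) hM hMi, hJ, ?_⟩
  have hnorm : ∀ b, ‖f.gnsStarAlgHom b ξ‖ ^ 2 = (φ (star b * b)).re := fun b => by
    rw [← hf, ← gns_inner, hπξ, inner_self_eq_norm_sq_to_K]
    norm_cast
  have hξ1 : ‖ξ‖ = 1 := by
    have := hnorm 1
    rw [map_one, one_apply_eq_self, star_one, one_mul, hφ.1.2.1, Complex.one_re] at this
    exact (pow_eq_one_iff_of_nonneg (norm_nonneg ξ) two_ne_zero).1 this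
  have h1 : ‖f.gnsStarAlgHom a ξ‖ ≤ ‖f.gnsStarAlgHom a‖ := by
    simpa [hξ1] using (f.gnsStarAlgHom a).le_opNorm ξ
  exact (le_of_sq_le_sq (hge.trans (hnorm a).ge) (norm_nonneg _)).trans h1

/-- Pass to the unitization: `A` embeds isometrically, `J` stays an ideal, and scalars preserve
every subspace, so restriction to `A` keeps irreducibility. -/
theorem exists_isIrreducibleRep_of_le_norm_add {A : Type u} [NonUnitalCStarAlgebra A]
    {J : Submodule ℂ A} (hl : ∀ j ∈ J, ∀ b, b * j ∈ J) (hr : ∀ j ∈ J, ∀ b, j * b ∈ J) {a : A}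
    {β : ℝ} (hβ : 0 < β) (ha : ∀ j ∈ J, β ≤ ‖a + j‖) :
    ∃ (H : Type u) (_ : NormedAddCommGroup H) (_ : InnerProductSpace ℂ H) (_ : CompleteSpace H)
      (π : A →⋆ₙₐ[ℂ] (H →L[ℂ] H)), IsIrreducibleRep π ∧ (∀ j ∈ J, π j = 0) ∧ β ≤ ‖π a‖ := by
  let i : A →⋆ₙₐ[ℂ] Unitization ℂ A := Unitization.inrNonUnitalStarAlgHom ℂ A
  let J' : Submodule ℂ (Unitization ℂ A) := J.map (Unitization.inrHom ℂ ℂ A)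
  have hmem : ∀ {x}, x ∈ J' ↔ ∃ j ∈ J, (j : Unitization ℂ A) = x := Submodule.mem_map
  obtain ⟨H, _, _, _, π, hirr, hJ, hge⟩ := exists_irreducible_of_le_norm_add (J := J')
    (a := (a : Unitization ℂ A)) (β := β) (by
      rintro _ hx b
      obtain ⟨j, hj, rfl⟩ := hmem.1 hx
      induction b using Unitization.ind with
      | inl_add_inr r x =>
        exact hmem.2 ⟨r • j + x * j, J.add_mem (J.smul_mem r hj) (hl j hj x), by
          simp [add_mul, Unitization.inl_mul_inr]⟩) (by
      rintro _ hx b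
      obtain ⟨j, hj, rfl⟩ := hmem.1 hx
      induction b using Unitization.ind with
      | inl_add_inr r x =>
        exact hmem.2 ⟨r • j + j * x, J.add_mem (J.smul_mem r hj) (hr j hj x), by
          simp [mul_add, Unitization.inr_mul_inl]⟩) hβ (by
      rintro _ hx
      obtain ⟨j, hj, rfl⟩ := hmem.1 hx
      rw [← Unitization.inr_add, Unitization.norm_inr]
      exact ha j hj)
  have hcomp : ∀ x, (π : Unitization ℂ A →⋆ₙₐ[ℂ] (H →L[ℂ] H)).comp i x
      = π (x : Unitization ℂ A) := fun x => rfl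
  refine ⟨H, _, _, _, (π : Unitization ℂ A →⋆ₙₐ[ℂ] (H →L[ℂ] H)).comp i, ⟨?_, ?_⟩, ?_, ?_⟩
  · intro h0
    have : π (a : Unitization ℂ A) = 0 := by rw [← hcomp, h0]; rfl
    rw [this, norm_zero] at hge
    exact hge.not_gt hβ
  · intro M hM hMi
    refine hirr M hM fun b v hv => ?_
    induction b using Unitization.ind with
    | inl_add_inr r x =>
      have h1 : π (Unitization.inl r) = r • (1 : H →L[ℂ] H) := by
        rw [← Unitization.algebraMap_eq_inl, AlgHomClass.commutes,
          Algebra.algebraMap_eq_smul_one]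
      rw [map_add, h1]
      exact M.add_mem (M.smul_mem r hv) (hMi x v hv)
  · intro j hj
    exact hJ _ (hmem.2 ⟨j, hj, rfl⟩)
  · exact hge

/-! ### Quotient norms -/

section CosetNorm

variable {A : Type u} [NonUnitalCStarAlgebra A]

theorem cosetNorm_le_norm_add {a x : A} {I : TwoSidedIdeal A} (hx : x ∈ I) :
    cosetNorm a I ≤ ‖a + x‖ := by
  have : (QuotientAddGroup.mk (a + x) : A ⧸ AddSubgroup.ofClass I) = QuotientAddGroup.mk a :=
    QuotientAddGroup.mk_add_of_mem a hx
  rw [cosetNorm, ← this]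
  exact QuotientAddGroup.norm_mk_le_norm

theorem le_cosetNorm {a : A} {I : TwoSidedIdeal A} {r : ℝ} (h : ∀ x ∈ I, r ≤ ‖a + x‖) :
    r ≤ cosetNorm a I := by
  refine le_of_forall_pos_le_add fun ε hε => ?_
  obtain ⟨x, hx, hlt⟩ := QuotientAddGroup.exists_norm_add_lt
    (AddSubgroup.ofClass I) a hε
  exact (h x hx).trans hlt.le

theorem cosetNorm_anti {I J : TwoSidedIdeal A} (h : I ≤ J) (a : A) :
    cosetNorm a J ≤ cosetNorm a I :=
  le_cosetNorm fun _ hx => cosetNorm_le_norm_add (h hx)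

theorem norm_map_le_cosetNorm {B : Type*} [NonUnitalCStarAlgebra B] (π : A →⋆ₙₐ[ℂ] B)
    {I : TwoSidedIdeal A} (hI : ∀ x ∈ I, π x = 0) (a : A) : ‖π a‖ ≤ cosetNorm a I :=
  le_cosetNorm fun x hx => by
    have := NonUnitalStarAlgHom.norm_apply_le π (a + x)
    rwa [map_add, hI x hx, add_zero] at this

/-- Every `a` is moved into the ball of radius `t` by an element lying in all the primitive ideals
modulo which `a` has norm at most `t`. -/
theorem exists_norm_add_le_of_cosetNorm_le (a : A) {t : ℝ} (ht : 0 < t) :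
    ∃ d : A, ‖a + d‖ ≤ t ∧ ∀ P : PrimSpace A, cosetNorm a P.1 ≤ t → d ∈ P.1 := by
  obtain ⟨d, hd, hπ⟩ := exists_norm_add_le_of_norm_map_le a ht
  refine ⟨d, hd, fun P hP => ?_⟩
  obtain ⟨H, _, _, _, π, -, hk⟩ := P.2
  exact (hk d).2 (hπ π ((norm_map_le_cosetNorm π (fun x hx => (hk x).1 hx) a).trans hP))

theorem cosetNorm_le_norm_map {B : Type*} [NonUnitalCStarAlgebra B] (π : A →⋆ₙₐ[ℂ] B)
    {I : TwoSidedIdeal A} (hI : ∀ x, π x = 0 → x ∈ I) (a : A) : cosetNorm a I ≤ ‖π a‖ := by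
  refine le_of_forall_gt_imp_ge_of_dense fun t ht => ?_
  obtain ⟨d, hd, hπ⟩ := exists_norm_add_le_of_norm_map_le a ((norm_nonneg _).trans_lt ht)
  exact (cosetNorm_le_norm_add (hI d (hπ π ht.le))).trans hd

end CosetNorm

/-! ### Semicontinuity and compactness in the primitive ideal space -/

section PrimSpace

variable {A : Type u} [NonUnitalCStarAlgebra A]

theorem isClosed_primSpace_iff {F : Set (PrimSpace A)} :
    IsClosed F ↔ ∃ I : TwoSidedIdeal A, idealHull I = F := by
  rw [← isOpen_compl_iff]
  change Fᶜᶜ ∈ Set.range idealHull ↔ _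
  rw [compl_compl, Set.mem_range]

theorem mem_of_isClosed_of_le {F : Set (PrimSpace A)} (hF : IsClosed F) {Q : PrimSpace A}
    (h : ∀ x, (∀ P ∈ F, x ∈ P.1) → x ∈ Q.1) : Q ∈ F := by
  obtain ⟨I, rfl⟩ := isClosed_primSpace_iff.1 hF
  exact fun x hx => h x fun P hP => hP hx

/-- A single truncating element `d` lies in every `P` of the set, hence in every `Q` containing
their intersection. -/
theorem isClosed_setOf_cosetNorm_le (a : A) {t : ℝ} (ht : 0 < t) :
    IsClosed {P : PrimSpace A | cosetNorm a P.1 ≤ t} := by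
  obtain ⟨d, hd, hP⟩ := exists_norm_add_le_of_cosetNorm_le a ht
  refine isClosed_primSpace_iff.2 ⟨sInf {I | ∃ P : PrimSpace A, cosetNorm a P.1 ≤ t ∧ P.1 = I}, ?_⟩
  ext Q
  constructor
  · intro hQ
    refine (cosetNorm_le_norm_add (hQ ?_)).trans hd
    rw [TwoSidedIdeal.mem_sInf]
    rintro _ ⟨P, hPt, rfl⟩
    exact hP P hPt
  · intro hQ
    refine sInf_le (a := Q.1) ?_
    exact ⟨Q, hQ, rfl⟩

theorem PrimSpace.smul_mem (P : PrimSpace A) (c : ℂ) {x : A} (hx : x ∈ P.1) : c • x ∈ P.1 := by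
  obtain ⟨H, _, _, _, π, -, hk⟩ := P.2
  rw [hk] at hx ⊢
  rw [map_smul, hx, smul_zero]

/-- The kernel of a set of primitive ideals. -/
def primKernel (F : Set (PrimSpace A)) : Submodule ℂ A where
  carrier := {x | ∀ P ∈ F, x ∈ P.1}
  add_mem' hx hy P hP := P.1.add_mem (hx P hP) (hy P hP)
  zero_mem' P _ := P.1.zero_mem
  smul_mem' c _ hx P hP := P.smul_mem c (hx P hP)

theorem isCompact_setOf_le_cosetNorm (a : A) {β : ℝ} (hβ : 0 < β) :
    IsCompact {P : PrimSpace A | β ≤ cosetNorm a P.1} := by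
  refine isCompact_of_finite_subfamily_closed fun {ι} F hF hempty => ?_
  -- The algebraic sum, not its closure: an element of `J` lies in a finite subsum, which selects
  -- the finite subfamily.
  let J : Submodule ℂ A := ⨆ i, primKernel (F i)
  have hl : ∀ j ∈ J, ∀ b, b * j ∈ J := fun j hj b => by
    refine Submodule.iSup_induction _ (motive := fun j => b * j ∈ J) hj (fun i x hx => ?_)
      (by simp) fun x y hx hy => by rw [mul_add]; exact J.add_mem hx hy
    exact Submodule.mem_iSup_of_mem i fun P hP => P.1.mul_mem_left b x (hx P hP)
  have hr : ∀ j ∈ J, ∀ b, j * b ∈ J := fun j hj b => by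
    refine Submodule.iSup_induction _ (motive := fun j => j * b ∈ J) hj (fun i x hx => ?_)
      (by simp) fun x y hx hy => by rw [add_mul]; exact J.add_mem hx hy
    exact Submodule.mem_iSup_of_mem i fun P hP => P.1.mul_mem_right x b (hx P hP)
  obtain ⟨j, hj, hlt⟩ : ∃ j ∈ J, ‖a + j‖ < β := by
    by_contra! hcon
    obtain ⟨H, _, _, _, π, hirr, hJ, hge⟩ := exists_isIrreducibleRep_of_le_norm_add hl hr hβ hcon
    let P : PrimSpace A := ⟨TwoSidedIdeal.ker π, H, _, _, _, π, hirr, fun x =>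
      TwoSidedIdeal.mem_ker π⟩
    have hP : P ∈ {P : PrimSpace A | β ≤ cosetNorm a P.1} ∩ ⋂ i, F i := by
      refine ⟨hge.trans (norm_map_le_cosetNorm π (fun x hx => (TwoSidedIdeal.mem_ker π).1 hx) a),
        Set.mem_iInter.2 fun i => mem_of_isClosed_of_le (hF i) fun x hx => ?_⟩
      exact (TwoSidedIdeal.mem_ker π).2 (hJ x (Submodule.mem_iSup_of_mem i hx))
    rw [hempty] at hP
    exact hP
  obtain ⟨s, hs⟩ := Submodule.mem_iSup_iff_exists_finset.1 hj
  refine ⟨s, Set.eq_empty_of_forall_notMem ?_⟩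
  rintro P ⟨hP, hPs⟩
  have hle : ⨆ i ∈ s, primKernel (F i) ≤ primKernel {P} := iSup₂_le fun i hi x hx Q hQ => by
    rw [Set.mem_singleton_iff.1 hQ]
    exact hx P (Set.mem_iInter₂.1 hPs i hi)
  have hjP : j ∈ P.1 := hle hs P rfl
  exact (hlt.trans_le hP).not_ge (cosetNorm_le_norm_add hjP)

theorem exists_one_lt_cosetNorm (P : PrimSpace A) : ∃ a : A, 1 < cosetNorm a P.1 := by
  obtain ⟨H, _, _, _, π, hirr, hk⟩ := P.2
  obtain ⟨a, ha⟩ : ∃ a, π a ≠ 0 := by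
    by_contra! h
    exact hirr.1 (by ext1 a; exact h a)
  have hpos : 0 < ‖π a‖ := norm_pos_iff.2 ha
  refine ⟨((2 / ‖π a‖ : ℝ) : ℂ) • a, lt_of_lt_of_le ?_
    (norm_map_le_cosetNorm π (fun x hx => (hk x).1 hx) _)⟩
  rw [map_smul, norm_smul, Complex.norm_real, Real.norm_of_nonneg (by positivity),
    div_mul_cancel₀ _ hpos.ne']
  norm_num

/-- Adding a positive element cannot lower the norm of a positive one; this is what merges local
choices. -/
theorem one_le_cosetNorm_star_mul_self_add {P : PrimSpace A} {a : A} (ha : 1 ≤ cosetNorm a P.1)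
    (b : A) : 1 ≤ cosetNorm (star a * a + star b * b) P.1 := by
  obtain ⟨H, _, _, _, π, -, hk⟩ := P.2
  have h1 : 1 ≤ ‖π a‖ := ha.trans (cosetNorm_le_norm_map π (fun x hx => (hk x).2 hx) a)
  refine le_trans ?_ (norm_map_le_cosetNorm π (fun x hx => (hk x).1 hx) _)
  have h2 : ‖star (π a) * π a‖ ≤ ‖star (π a) * π a + star (π b) * π b‖ :=
    CStarAlgebra.norm_le_norm_of_nonneg_of_le (star_mul_self_nonneg _)
      (le_add_of_nonneg_right (star_mul_self_nonneg _))
  rw [CStarRing.norm_star_mul_self] at h2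
  rw [map_add, map_mul, map_mul, map_star, map_star]
  nlinarith

theorem exists_one_le_cosetNorm_of_isCompact {C : Set (PrimSpace A)} (hC : IsCompact C) :
    ∃ a : A, ∀ P ∈ C, 1 ≤ cosetNorm a P.1 := by
  refine hC.induction_on (p := fun S => ∃ a : A, ∀ P ∈ S, 1 ≤ cosetNorm a P.1) ⟨0, by simp⟩
    (fun S T hST ⟨a, ha⟩ => ⟨a, fun P hP => ha P (hST hP)⟩) ?_ fun P _ => ?_
  · rintro S T ⟨a, ha⟩ ⟨b, hb⟩
    refine ⟨star a * a + star b * b, ?_⟩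
    rintro P (hP | hP)
    · exact one_le_cosetNorm_star_mul_self_add (ha P hP) b
    · rw [add_comm]
      exact one_le_cosetNorm_star_mul_self_add (hb P hP) a
  · obtain ⟨a, ha⟩ := exists_one_lt_cosetNorm P
    have hopen : IsOpen {Q : PrimSpace A | 1 < cosetNorm a Q.1} := by
      have := (isClosed_setOf_cosetNorm_le a one_pos).isOpen_compl
      simpa only [Set.compl_ofPred, not_le] using this
    exact ⟨_, mem_nhdsWithin_of_mem_nhds (hopen.mem_nhds ha), a, fun Q hQ => le_of_lt hQ⟩

end PrimSpace

/-! ### The Glimm space -/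

section GlimmSpace

variable {A : Type u} [NonUnitalCStarAlgebra A]

/-- Equivalence classes are closed, being cut out by continuous functions, so each contains the hull
of its kernel. -/
theorem primEquiv_of_glimmIdeal_le {P Q : PrimSpace A} (h : glimmIdeal P ≤ Q.1) :
    primEquiv P Q := by
  have hcl : IsClosed {R : PrimSpace A | primEquiv P R} := by
    have : {R : PrimSpace A | primEquiv P R} = ⋂ f : PrimSpace A →ᵇ ℝ, {R | f P = f R} := by
      ext R; simp [primEquiv]
    rw [this]
    exact isClosed_iInter fun f => isClosed_eq continuous_const f.continuous
  refine mem_of_isClosed_of_le hcl fun x hx => h ?_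
  rw [glimmIdeal, TwoSidedIdeal.mem_sInf]
  rintro _ ⟨R, hR, rfl⟩
  exact hx R hR

theorem glimmIdeal_le (P : PrimSpace A) : glimmIdeal P ≤ P.1 :=
  sInf_le ⟨P, fun _ => rfl, rfl⟩

theorem glimmMap_eq_iff {P Q : PrimSpace A} : glimmMap A P = glimmMap A Q ↔ primEquiv P Q := by
  constructor
  · intro h
    refine primEquiv_of_glimmIdeal_le (le_trans (le_of_eq ?_) (glimmIdeal_le Q))
    exact congrArg Subtype.val h
  · intro h
    have : ∀ R, primEquiv P R ↔ primEquiv Q R := fun R =>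
      ⟨fun hR f => (h f).symm.trans (hR f), fun hR f => (h f).trans (hR f)⟩
    exact Subtype.ext (by simp only [glimmMap, glimmIdeal, this])

theorem glimmMap_surjective : Function.Surjective (glimmMap A) := by
  rintro ⟨_, P, rfl⟩
  exact ⟨P, rfl⟩

theorem continuous_glimmMap_tauCR : @Continuous _ _ _ (tauCR A) (glimmMap A) := by
  refine continuous_iInf_rng.2 fun g => continuous_iInf_rng.2 fun ⟨f, hf⟩ =>
    continuous_induced_rng.2 ?_
  exact f.continuous.congr fun P => (hf P).symm

theorem t2Space_tauCR : @T2Space (GlimmSpace A) (tauCR A) := by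
  let := tauCR A
  refine ⟨fun G₁ G₂ hne => ?_⟩
  obtain ⟨P, rfl⟩ := glimmMap_surjective G₁
  obtain ⟨Q, rfl⟩ := glimmMap_surjective G₂
  obtain ⟨f, hf⟩ : ∃ f : PrimSpace A →ᵇ ℝ, f P ≠ f Q := by
    by_contra! h
    exact hne (glimmMap_eq_iff.2 h)
  let g : GlimmSpace A → ℝ := fun G => f (Function.surjInv glimmMap_surjective G)
  have hg : ∀ R, g (glimmMap A R) = f R := fun R =>
    glimmMap_eq_iff.1 (Function.surjInv_eq glimmMap_surjective (glimmMap A R)) f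
  have hcont : Continuous g :=
    continuous_iInf_dom (i := g) (continuous_iInf_dom (i := ⟨f, hg⟩) continuous_induced_dom)
  exact separated_by_continuous hcont (by rwa [hg, hg])

theorem exists_primEquiv_le_cosetNorm {a : A} {α t : ℝ} (ht : 0 < t) (htα : t < α)
    {P : PrimSpace A} (h : α ≤ cosetNorm a (glimmMap A P).1) :
    ∃ Q, primEquiv P Q ∧ t ≤ cosetNorm a Q.1 := by
  by_contra! hcon
  obtain ⟨d, hd, hdP⟩ := exists_norm_add_le_of_cosetNorm_le a ht
  have hmem : d ∈ (glimmMap A P).1 := by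
    change d ∈ glimmIdeal P
    rw [glimmIdeal, TwoSidedIdeal.mem_sInf]
    rintro _ ⟨R, hR, rfl⟩
    exact hdP R (hcon R hR).le
  exact (htα.trans_le h).not_ge ((cosetNorm_le_norm_add hmem).trans hd)

theorem exists_isCompact_image_glimmMap_eq {K : Set (GlimmSpace A)}
    (hK : @IsCompact (GlimmSpace A) (tauCR A) K)
    (h : ∃ a : A, ∃ α : ℝ, 0 < α ∧ K ⊆ {G : GlimmSpace A | α ≤ cosetNorm a G.1}) :
    ∃ C : Set (PrimSpace A), IsCompact C ∧ glimmMap A '' C = K := by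
  obtain ⟨a, α, hα, hKa⟩ := h
  have hclosed : IsClosed (glimmMap A ⁻¹' K) :=
    @IsClosed.preimage _ _ _ (tauCR A) _ continuous_glimmMap_tauCR _
      (@IsCompact.isClosed _ (tauCR A) t2Space_tauCR _ hK)
  -- Truncation needs a level strictly between 0 and `α`; `α / 2` is one.
  refine ⟨{P | α / 2 ≤ cosetNorm a P.1} ∩ glimmMap A ⁻¹' K,
    (isCompact_setOf_le_cosetNorm a (half_pos hα)).inter_right hclosed,
    Set.Subset.antisymm ?_ fun G hG => ?_⟩
  · rintro _ ⟨P, hP, rfl⟩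
    exact hP.2
  · obtain ⟨P, rfl⟩ := glimmMap_surjective G
    have hle := hKa hG
    rw [Set.mem_ofPred_eq] at hle
    obtain ⟨Q, hPQ, hQ⟩ := exists_primEquiv_le_cosetNorm (half_pos hα) (half_lt_self hα) hle
    have hq : glimmMap A P = glimmMap A Q := glimmMap_eq_iff.2 hPQ
    exact ⟨Q, ⟨hQ, (hq ▸ hG : glimmMap A Q ∈ K)⟩, hq.symm⟩

end GlimmSpace

theorem mainTheorem3 {A : Type u} [NonUnitalCStarAlgebra A] (K : Set (GlimmSpace A))
    (hK : @IsCompact (GlimmSpace A) (tauCR A) K) :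
    ((∃ a : A, ∃ α : ℝ, 0 < α ∧ K ⊆ {G : GlimmSpace A | α ≤ cosetNorm a G.1}) ↔
      ∃ C : Set (PrimSpace A), IsCompact C ∧ glimmMap A '' C = K) ∧
    ((∃ a : A, ∃ α : ℝ, 0 < α ∧ K ⊆ {G : GlimmSpace A | α ≤ cosetNorm a G.1}) →
      @IsCompact (GlimmSpace A) (tauQ A) K) := by
  refine ⟨⟨exists_isCompact_image_glimmMap_eq hK, ?_⟩, fun h => ?_⟩
  · rintro ⟨C, hC, rfl⟩
    obtain ⟨a, ha⟩ := exists_one_le_cosetNorm_of_isCompact hC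
    refine ⟨a, 1, one_pos, ?_⟩
    rintro _ ⟨P, hP, rfl⟩
    exact (ha P hP).trans (cosetNorm_anti (glimmIdeal_le P) a)
  · obtain ⟨C, hC, rfl⟩ := exists_isCompact_image_glimmMap_eq hK h
    exact @IsCompact.image _ _ _ (tauQ A) _ _ hC continuous_coinduced_rng
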